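/- For $\hbar>0$ let $X$ and $\Xi$ denote the position and momentum operators on $L^2(\mathbb R)$, that is, the self-adjoint operators $$Xf(x)=xf(x),\qquad \Xi f(x)=-i\hbar f'(x),$$ with domains $\{f\in L^2(\mathbb R): xf\in L^2(\mathbb R)\}$ and $\{f\in L^2(\mathbb R): f'\in L^2(\mathbb R)\}$ respectively (the derivative is taken in the sense of distributions). Consider the commutator $$C^{(1)}_\hbar=[\Pi_X,\Pi_\Xi]=\Pi_X\Pi_\Xi-\Pi_\Xi\Pi_X,\qquad \Pi_X=\mathbf 1_{(0,\infty)}(X),\quad \Pi_\Xi=\mathbf 1_{(0,\infty)}(\Xi),$$ of the spectral projections of $X$ and $\Xi$ corresponding to $(0,\infty)$. Then $C^{(1)}_\hbar\equiv C^{(1)}$ is independent of $\hbar$, and its operator norm on $L^2(\mathbb R)$ is $\Vert C^{(1)}\Vert_{\mathrm{op}}=\frac12$. -/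

import Mathlib

open MeasureTheory Set
open scoped SchwartzMap ENNReal

noncomputable section

section SpectralTheory

variable {H : Type*} [NormedAddCommGroup H] [InnerProductSpace ℂ H] [CompleteSpace H]

/-- A projection-valued measure on the Borel sets of `ℝ`, with values in the orthogonal projections
of the complex Hilbert space `H`, countably additive in the strong operator topology.
(The values at non-measurable sets carry no information.) -/
structure ProjectionValuedMeasure (H : Type*) [NormedAddCommGroup H] [InnerProductSpace ℂ H]
    [CompleteSpace H] where
  /-- The projection attached to a set. -/
  proj : Set ℝ → H →L[ℂ] H
  isStarProjection : ∀ B, MeasurableSet B → IsStarProjection (proj B)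
  proj_empty : proj ∅ = 0
  proj_univ : proj univ = 1
  proj_inter : ∀ B B', MeasurableSet B → MeasurableSet B' → proj (B ∩ B') = proj B * proj B'
  hasSum_iUnion : ∀ B : ℕ → Set ℝ, (∀ n, MeasurableSet (B n)) →
    Pairwise (Function.onFun Disjoint B) → ∀ x, HasSum (fun n => proj (B n) x) (proj (⋃ n, B n) x)

namespace ProjectionValuedMeasure

theorem re_inner_nonneg (E : ProjectionValuedMeasure H) {B : Set ℝ} (hB : MeasurableSet B) (x : H) :
    0 ≤ (inner ℂ x (E.proj B x)).re := by
  have h := E.isStarProjection B hB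
  have h1 : E.proj B x = E.proj B (E.proj B x) := by
    have := congrArg (fun T : H →L[ℂ] H => T x) h.isIdempotentElem.eq
    simpa using this.symm
  have h2 : inner ℂ x (E.proj B (E.proj B x)) = inner ℂ (E.proj B x) (E.proj B x) := by
    rw [← ContinuousLinearMap.adjoint_inner_left, h.isSelfAdjoint.adjoint_eq]
  rw [h1, h2]
  exact inner_self_nonneg (𝕜 := ℂ)

/-- The scalar spectral measure `B ↦ ⟨x, E(B) x⟩` of a vector `x`. -/
def scalarMeasure (E : ProjectionValuedMeasure H) (x : H) : Measure ℝ :=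
  Measure.ofMeasurable (fun B _ => ENNReal.ofReal (inner ℂ x (E.proj B x)).re)
    (by simp [E.proj_empty])
    (by
      intro B hB hd
      have h := ((E.hasSum_iUnion B hB hd x).mapL (innerSL ℂ x)).mapL Complex.reCLM
      simp only [innerSL_apply_apply, Complex.reCLM_apply] at h
      rw [← h.tsum_eq]
      exact ENNReal.ofReal_tsum_of_nonneg (fun n => E.re_inner_nonneg (hB n) x) h.summable)

/-- `E` is the spectral measure of the (possibly unbounded) operator `A`, i.e. `A = ∫ t dE(t)`:
the domain of `A` consists of the `x` with `∫ t² d⟨x, E(t) x⟩ < ∞`, and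
`⟨x, A x⟩ = ∫ t d⟨x, E(t) x⟩` on this domain. -/
def IsSpectralMeasureOf (E : ProjectionValuedMeasure H) (A : H →ₗ.[ℂ] H) : Prop :=
  (∀ x, x ∈ A.domain ↔ ∫⁻ t, ENNReal.ofReal (t ^ 2) ∂(E.scalarMeasure x) < ∞) ∧
  ∀ x : A.domain, inner ℂ (x : H) (A x) = ((∫ t, t ∂(E.scalarMeasure (x : H)) : ℝ) : ℂ)

end ProjectionValuedMeasure

open Classical in
/-- The spectral projection `1_B(A)` of an operator `A`: the unique operator that is the value at
`B` of a spectral measure of `A` (and `0` if `A` has no spectral measure, or if the value at `B`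
were not unique; neither occurs for self-adjoint `A` and Borel `B`). -/
def spectralProjection (A : H →ₗ.[ℂ] H) (B : Set ℝ) : H →L[ℂ] H :=
  if h : ∃! P : H →L[ℂ] H,
      ∃ E : ProjectionValuedMeasure H, E.IsSpectralMeasureOf A ∧ E.proj B = P
  then h.choose else 0

end SpectralTheory

section PositionMomentum

/-- The complex Hilbert space `L²(ℝ)`. -/
abbrev L2Line : Type := Lp ℂ 2 (volume : Measure ℝ)

/-- Pairs `(f, g)` in `L²(ℝ)` with `g(x) = x f(x)` almost everywhere. -/
def positionGraph : Submodule ℂ (L2Line × L2Line) where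
  carrier := {p | ∀ᵐ x : ℝ, p.2 x = (x : ℂ) * p.1 x}
  zero_mem' := by
    filter_upwards [Lp.coeFn_zero ℂ 2 (volume : Measure ℝ)] with x hx
    simp
  add_mem' := by
    intro p q hp hq
    filter_upwards [hp, hq, Lp.coeFn_add p.1 q.1, Lp.coeFn_add p.2 q.2] with x h1 h2 h3 h4
    simp only [Prod.fst_add, Prod.snd_add, h3, h4, Pi.add_apply, h1, h2]
    ring
  smul_mem' := by
    intro c p hp
    filter_upwards [hp, Lp.coeFn_smul c p.1, Lp.coeFn_smul c p.2] with x h1 h2 h3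
    simp only [Prod.smul_fst, Prod.smul_snd, h2, h3, Pi.smul_apply, h1, smul_eq_mul]
    ring

theorem positionGraph_functional (p : L2Line × L2Line) (hp : p ∈ positionGraph) (h0 : p.1 = 0) :
    p.2 = 0 := by
  rw [Lp.eq_zero_iff_ae_eq_zero]
  have hp' : ∀ᵐ x : ℝ, p.2 x = (x : ℂ) * p.1 x := hp
  have h1 := (Lp.eq_zero_iff_ae_eq_zero (f := p.1)).1 h0
  filter_upwards [hp', h1] with x hx hx1
  simp [hx, hx1]

/-- The position operator `X f(x) = x f(x)` on its maximal domain
`{f ∈ L²(ℝ) | x f(x) ∈ L²(ℝ)}`. -/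
def positionOp : L2Line →ₗ.[ℂ] L2Line := positionGraph.toLinearPMap

theorem positionOp_graph : positionOp.graph = positionGraph :=
  Submodule.toLinearPMap_graph_eq _ positionGraph_functional

/-- Pairs `(f, g)` in `L²(ℝ)` with `g = -iħ f'`, the derivative being taken in the sense of
(tempered) distributions. -/
def momentumGraph (hbar : ℝ) : Submodule ℂ (L2Line × L2Line) where
  carrier := {p | Lp.toTemperedDistributionCLM ℂ volume 2 p.2 =
    (-(Complex.I * (hbar : ℂ))) •
      TemperedDistribution.derivCLM ℂ (Lp.toTemperedDistributionCLM ℂ volume 2 p.1)}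
  zero_mem' := by
    simp only [mem_ofPred_eq, Prod.fst_zero, Prod.snd_zero, map_zero]
    exact (smul_zero (M := ℂ) (A := 𝓢'(ℝ, ℂ)) _).symm
  add_mem' := by
    intro p q hp hq
    simp only [mem_ofPred_eq, Prod.fst_add, Prod.snd_add, map_add, smul_add] at hp hq ⊢
    rw [hp, hq]
  smul_mem' := by
    intro c p hp
    simp only [mem_ofPred_eq, Prod.smul_fst, Prod.smul_snd, map_smul] at hp ⊢
    rw [hp, smul_comm]

theorem momentumGraph_functional (hbar : ℝ) (p : L2Line × L2Line) (hp : p ∈ momentumGraph hbar)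
    (h0 : p.1 = 0) : p.2 = 0 := by
  have hp' : Lp.toTemperedDistributionCLM ℂ volume 2 p.2 =
      (-(Complex.I * (hbar : ℂ))) •
        TemperedDistribution.derivCLM ℂ (Lp.toTemperedDistributionCLM ℂ volume 2 p.1) := hp
  rw [h0, map_zero, map_zero] at hp'
  have hk : p.2 ∈ (Lp.toTemperedDistributionCLM ℂ (volume : Measure ℝ) 2).ker :=
    hp'.trans (smul_zero (M := ℂ) (A := 𝓢'(ℝ, ℂ)) _)
  rwa [Lp.ker_toTemperedDistributionCLM_eq_bot, Submodule.mem_bot] at hk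

/-- The momentum operator `Ξ f = -iħ f'` on its maximal domain, which for `ħ ≠ 0` is the Sobolev
space `H¹(ℝ) = {f ∈ L²(ℝ) | f' ∈ L²(ℝ)}`. -/
def momentumOp (hbar : ℝ) : L2Line →ₗ.[ℂ] L2Line := (momentumGraph hbar).toLinearPMap

theorem momentumOp_graph (hbar : ℝ) : (momentumOp hbar).graph = momentumGraph hbar :=
  Submodule.toLinearPMap_graph_eq _ (momentumGraph_functional hbar)

/-- The commutator `[1_{(0,∞)}(X), 1_{(0,∞)}(Ξ)]` on `L²(ℝ)`. -/
def lineCommutator (hbar : ℝ) : L2Line →L[ℂ] L2Line :=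
  ⁅spectralProjection positionOp (Ioi 0), spectralProjection (momentumOp hbar) (Ioi 0)⁆

end PositionMomentum

end

/-! Write `P` for multiplication by the indicator of the positive half-line and `Q` for the Fourier
multiplier with the same indicator. The Fourier transform turns `Ξ` into multiplication by `2πħξ`,
whose sign is that of `ξ` when `ħ > 0`; hence the spectral projection of `Ξ` is `Q` for every `ħ`.
Since `spectralProjection` is given by unique existence, this also needs that any two spectral
measures of one operator agree at `(0, ∞)` (`proj_Ioi_unique`).

Upper bound: relative to `P`, the commutator of two orthogonal projections consists, up to sign, of
the off-diagonal blocks of `Q`, and each block has norm at most `1/2` because `Q` is a projection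
(`norm_lie_le`).

Lower bound: test on `u = x^(a-1) e^(-x)` on the positive half-line and on its reflection `v`, with
`a = 1/2 + δ`. Then `⟨u, C v⟩ = ⟨û, 1_{ξ>0} v̂⟩ = Γ(a)² ∫_0^∞ (1 - 2πiξ)^(-2a) dξ` has modulus
`Γ(a)² / (4πδ)`, whereas `‖u‖ ‖v‖ = 2^(-2δ) Γ(2δ)` behaves like `1/(2δ)`. As `δ → 0` the quotient
tends to `Γ(1/2)² / (2π) = 1/2`. -/

/-- A symmetric operator whose quadratic form is bounded by `r` is bounded by `r`. -/
theorem LinearMap.IsSymmetric.norm_apply_le_of_abs_re_inner_le {H : Type*}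
    [NormedAddCommGroup H] [InnerProductSpace ℂ H] {T : H →ₗ[ℂ] H} (hT : T.IsSymmetric) {r : ℝ}
    (h : ∀ x, |(inner ℂ x (T x)).re| ≤ r * ‖x‖ ^ 2) (x : H) :
    ‖T x‖ ≤ r * ‖x‖ := by
  have key : ∀ x y : H, 2 * (inner ℂ y (T x)).re ≤ r * (‖x‖ ^ 2 + ‖y‖ ^ 2) := by
    intro x y
    have h1 := (abs_le.1 (h (x + y))).2
    have h2 := (abs_le.1 (h (x - y))).1
    have h3 := parallelogram_law_with_norm ℂ x y
    have h4 : (inner ℂ x (T y)).re = (inner ℂ y (T x)).re := by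
      rw [← hT x y, ← inner_conj_symm, Complex.conj_re]
    simp only [map_add, map_sub, inner_add_left, inner_add_right, inner_sub_left, inner_sub_right,
      Complex.add_re, Complex.sub_re] at h1 h2
    linear_combination h1 / 2 + h2 / 2 + r / 2 * h3 - h4
  rcases eq_or_ne x 0 with rfl | hx
  · simp
  rcases eq_or_ne (T x) 0 with h0 | h0
  · have := (abs_nonneg _).trans (h x)
    have hx2 : 0 < ‖x‖ ^ 2 := by positivity
    have hr : 0 ≤ r := by
      by_contra hr
      push Not at hr
      nlinarith
    rw [h0, norm_zero]
    positivity
  · have hx' : 0 < ‖x‖ := norm_pos_iff.2 hx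
    have h0' : 0 < ‖T x‖ := norm_pos_iff.2 h0
    -- The polarized bound is sharpest for vectors of equal norm, so `T x` is rescaled to length
    -- `‖x‖`.
    have h1 := key x (((‖x‖ / ‖T x‖ : ℝ) : ℂ) • T x)
    rw [inner_smul_left, Complex.conj_ofReal, Complex.re_ofReal_mul, norm_smul,
      Complex.norm_real, Real.norm_of_nonneg (by positivity), div_mul_cancel₀ _ h0'.ne',
      inner_self_eq_norm_sq_to_K] at h1
    have h2 : (((‖T x‖ : ℂ)) ^ 2).re = ‖T x‖ ^ 2 := by norm_cast
    simp only [Complex.coe_algebraMap, h2] at h1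
    have h3 : ‖x‖ / ‖T x‖ * ‖T x‖ ^ 2 = ‖x‖ * ‖T x‖ := by field_simp
    rw [h3] at h1
    have h4 : ‖x‖ * ‖T x‖ ≤ ‖x‖ * (r * ‖x‖) := by nlinarith
    exact le_of_mul_le_mul_left h4 hx'

/-! ### Uniqueness of the spectral projection onto the positive half-line -/

section SpectralUniqueness

variable {H : Type*} [NormedAddCommGroup H] [InnerProductSpace ℂ H] [CompleteSpace H]

namespace IsStarProjection

theorem apply_apply {P : H →L[ℂ] H} (hP : IsStarProjection P) (x : H) : P (P x) = P x := by
  simpa using congrArg (fun T : H →L[ℂ] H => T x) hP.isIdempotentElem.eq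

theorem inner_left {P : H →L[ℂ] H} (hP : IsStarProjection P) (x y : H) :
    inner ℂ (P x) y = inner ℂ x (P y) := by
  rw [← ContinuousLinearMap.adjoint_inner_right, hP.isSelfAdjoint.adjoint_eq]

theorem inner_apply_self {P : H →L[ℂ] H} (hP : IsStarProjection P) (x : H) :
    inner ℂ x (P x) = ((‖P x‖ ^ 2 : ℝ) : ℂ) := by
  rw [← hP.apply_apply x, ← hP.inner_left, hP.apply_apply, inner_self_eq_norm_sq_to_K]
  norm_cast

end IsStarProjection

namespace ProjectionValuedMeasure

variable (E : ProjectionValuedMeasure H)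

theorem proj_proj {B C : Set ℝ} (hB : MeasurableSet B) (hC : MeasurableSet C) (x : H) :
    E.proj B (E.proj C x) = E.proj (B ∩ C) x := by
  rw [E.proj_inter B C hB hC]; rfl

theorem proj_comm {B C : Set ℝ} (hB : MeasurableSet B) (hC : MeasurableSet C) (x : H) :
    E.proj B (E.proj C x) = E.proj C (E.proj B x) := by
  rw [E.proj_proj hB hC, E.proj_proj hC hB, inter_comm]

theorem scalarMeasure_apply (x : H) {B : Set ℝ} (hB : MeasurableSet B) :
    E.scalarMeasure x B = ENNReal.ofReal (‖E.proj B x‖ ^ 2) := by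
  rw [scalarMeasure, Measure.ofMeasurable_apply B hB,
    (E.isStarProjection B hB).inner_apply_self, Complex.ofReal_re]

theorem scalarMeasure_univ (x : H) : E.scalarMeasure x univ = ENNReal.ofReal (‖x‖ ^ 2) := by
  rw [E.scalarMeasure_apply x .univ, E.proj_univ]; rfl

instance isFiniteMeasure_scalarMeasure (x : H) : IsFiniteMeasure (E.scalarMeasure x) :=
  ⟨by rw [scalarMeasure_univ]; exact ENNReal.ofReal_lt_top⟩

theorem scalarMeasure_real_univ (x : H) : (E.scalarMeasure x).real univ = ‖x‖ ^ 2 := by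
  rw [Measure.real, scalarMeasure_univ, ENNReal.toReal_ofReal (by positivity)]

theorem scalarMeasure_eq_zero_iff (x : H) {B : Set ℝ} (hB : MeasurableSet B) :
    E.scalarMeasure x B = 0 ↔ E.proj B x = 0 := by
  rw [E.scalarMeasure_apply x hB, ENNReal.ofReal_eq_zero]
  constructor
  · intro h
    have : ‖E.proj B x‖ ^ 2 = 0 := le_antisymm h (by positivity)
    simpa using this
  · intro h; simp [h]

theorem proj_iUnion_eq_zero {B : ℕ → Set ℝ} (hB : ∀ n, MeasurableSet (B n)) {x : H}
    (h : ∀ n, E.proj (B n) x = 0) : E.proj (⋃ n, B n) x = 0 := by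
  rw [← E.scalarMeasure_eq_zero_iff x (MeasurableSet.iUnion hB), measure_iUnion_null_iff]
  exact fun n => (E.scalarMeasure_eq_zero_iff x (hB n)).2 (h n)

theorem scalarMeasure_proj (x : H) {B : Set ℝ} (hB : MeasurableSet B) :
    E.scalarMeasure (E.proj B x) = (E.scalarMeasure x).restrict B := by
  ext C hC
  rw [Measure.restrict_apply hC, E.scalarMeasure_apply _ hC,
    E.scalarMeasure_apply _ (hC.inter hB), E.proj_proj hC hB]

theorem proj_add_proj_compl (x : H) {B : Set ℝ} (hB : MeasurableSet B) :
    E.proj B x + E.proj Bᶜ x = x := by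
  have h := E.hasSum_iUnion (fun n => if n = 0 then B else if n = 1 then Bᶜ else ∅)
    (fun n => by split_ifs <;> simp [hB])
    (fun m n hmn => by
      simp only [Function.onFun]
      split_ifs <;> simp_all [disjoint_compl_right, disjoint_compl_left]) x
  have hU : (⋃ n : ℕ, if n = 0 then B else if n = 1 then Bᶜ else ∅) = univ := by
    refine eq_univ_of_forall fun t => mem_iUnion.2 ?_
    by_cases ht : t ∈ B
    · exact ⟨0, by simpa using ht⟩
    · exact ⟨1, by simpa using ht⟩
  rw [hU, E.proj_univ] at h
  have h2 := hasSum_sum_of_ne_finset_zero (L := .unconditional ℕ) (s := Finset.range 2)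
    (f := fun n : ℕ => E.proj (if n = 0 then B else if n = 1 then Bᶜ else ∅) x) (by
      intro n hn
      simp only [Finset.mem_range, not_lt] at hn
      rw [if_neg (by omega), if_neg (by omega), E.proj_empty]; rfl)
  have h3 := h2.unique h
  simpa [Finset.sum_range_succ] using h3

/-- All `E(C)` commute with `E(B)`, so `E(C) u` and `E(C) v` stay in the range and the kernel of
`E(B)`; Pythagoras applies. -/
theorem scalarMeasure_add {u v : H} {B : Set ℝ} (hB : MeasurableSet B)
    (hu : E.proj B u = u) (hv : E.proj B v = 0) :
    E.scalarMeasure (u + v) = E.scalarMeasure u + E.scalarMeasure v := by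
  ext C hC
  rw [Measure.add_apply, E.scalarMeasure_apply _ hC, E.scalarMeasure_apply _ hC,
    E.scalarMeasure_apply _ hC, ← ENNReal.ofReal_add (by positivity) (by positivity), map_add]
  congr 1
  have h0 : inner ℂ (E.proj C u) (E.proj C v) = 0 := by
    rw [← hu, E.proj_comm hC hB, (E.isStarProjection B hB).inner_left, E.proj_comm hB hC, hv,
      map_zero, inner_zero_right]
  have := norm_add_sq_eq_norm_sq_add_norm_sq_of_inner_eq_zero _ _ h0
  nlinarith

namespace IsSpectralMeasureOf

variable {E} {A : H →ₗ.[ℂ] H}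

theorem proj_mem_domain (h : E.IsSpectralMeasureOf A) {x : H} (hx : x ∈ A.domain) {B : Set ℝ}
    (hB : MeasurableSet B) : E.proj B x ∈ A.domain := by
  rw [h.1] at hx ⊢
  rw [E.scalarMeasure_proj x hB]
  exact (lintegral_mono' Measure.restrict_le_self le_rfl).trans_lt hx

theorem proj_mem_domain_of_subset_Icc (h : E.IsSpectralMeasureOf A) (x : H) {B : Set ℝ}
    (hB : MeasurableSet B) {a b : ℝ} (hab : B ⊆ Icc a b) : E.proj B x ∈ A.domain := by
  rw [h.1, E.scalarMeasure_proj x hB]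
  refine setLIntegral_lt_top_of_le_nnreal (measure_ne_top _ _) ⟨(max |a| |b| ^ 2).toNNReal, ?_⟩
  intro t ht
  refine ENNReal.ofReal_le_ofReal ?_
  rw [← sq_abs]
  gcongr
  exact abs_le_max_abs_abs (hab ht).1 (hab ht).2

theorem integrable_id (h : E.IsSpectralMeasureOf A) {x : H} (hx : x ∈ A.domain) :
    Integrable (fun t : ℝ => t) (E.scalarMeasure x) := by
  rw [h.1] at hx
  have h2 : MemLp (fun t : ℝ => t) 2 (E.scalarMeasure x) := by
    rw [memLp_two_iff_integrable_sq (by fun_prop)]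
    refine ⟨by fun_prop, ?_⟩
    rw [hasFiniteIntegral_iff_ofReal (ae_of_all _ fun t => sq_nonneg t)]
    exact hx
  exact h2.integrable one_le_two

/-- Only the quadratic form of `A` is given. Additivity of the scalar measures kills the cross terms
`⟨u, Av⟩ + ⟨v, Au⟩`; replacing `v` by `iv` kills their difference as well. -/
theorem inner_apply_eq_zero (h : E.IsSpectralMeasureOf A) (u v : A.domain) {B : Set ℝ}
    (hB : MeasurableSet B) (hu : E.proj B u = u) (hv : E.proj B v = 0) :
    inner ℂ (u : H) (A v) = 0 := by
  have key : ∀ w : A.domain, E.proj B w = 0 →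
      inner ℂ (u : H) (A w) + inner ℂ (w : H) (A u) = 0 := by
    intro w hw
    have h1 := h.2 (u + w)
    rw [Submodule.coe_add, E.scalarMeasure_add hB hu hw,
      integral_add_measure (h.integrable_id u.2) (h.integrable_id w.2), LinearPMap.map_add,
      Complex.ofReal_add, ← h.2 u, ← h.2 w, inner_add_left, inner_add_right, inner_add_right] at h1
    linear_combination h1
  have h1 := key v hv
  have h2 := key (Complex.I • v) (by simp [hv])
  rw [LinearPMap.map_smul, Submodule.coe_smul, inner_smul_right, inner_smul_left,
    Complex.conj_I] at h2
  have h3 : Complex.I * (2 * inner ℂ (u : H) (A v)) = 0 := by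
    linear_combination h2 + Complex.I * h1
  simpa using h3

theorem proj_apply_eq_zero (h : E.IsSpectralMeasureOf A) (v : A.domain) {B : Set ℝ}
    (hB : MeasurableSet B) (hv : E.proj B v = 0) : E.proj B (A v) = 0 := by
  have key : ∀ n : ℕ, E.proj (Icc (-n : ℝ) n) (E.proj B (A v)) = 0 := by
    intro n
    set S := Icc (-n : ℝ) n
    -- `E(B)(A v)` itself need not lie in the domain of `A`; cutting it down to a bounded spectral
    -- window makes it an admissible test vector.
    have hS : MeasurableSet S := measurableSet_Icc
    have hmem : E.proj B (E.proj S (A v)) ∈ A.domain :=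
      h.proj_mem_domain (h.proj_mem_domain_of_subset_Icc _ hS subset_rfl) hB
    have h0 : inner ℂ (E.proj B (E.proj S (A v))) (A v) = 0 := h.inner_apply_eq_zero ⟨_, hmem⟩ v hB
      ((E.isStarProjection B hB).apply_apply _) hv
    rw [E.proj_proj hS hB]
    rw [E.proj_proj hB hS, inter_comm,
      (E.isStarProjection _ (hS.inter hB)).inner_left,
      (E.isStarProjection _ (hS.inter hB)).inner_apply_self] at h0
    simpa using h0
  have h1 := E.proj_iUnion_eq_zero (fun n : ℕ => measurableSet_Icc) key
  have hU : (⋃ n : ℕ, Icc (-n : ℝ) n) = univ := by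
    refine eq_univ_of_forall fun t => mem_iUnion.2 ?_
    obtain ⟨n, hn⟩ := exists_nat_ge |t|
    exact ⟨n, abs_le.1 hn⟩
  rw [hU, E.proj_univ] at h1
  simpa using h1

/-- Split `x` into `E(B) x` and `E(Bᶜ) x`: by `proj_apply_eq_zero`, `A` keeps each piece in its own
spectral subspace. -/
theorem proj_apply (h : E.IsSpectralMeasureOf A) (x : A.domain) {B : Set ℝ}
    (hB : MeasurableSet B) :
    E.proj B (A x) = A ⟨E.proj B x, h.proj_mem_domain x.2 hB⟩ := by
  set x₁ : A.domain := ⟨E.proj B x, h.proj_mem_domain x.2 hB⟩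
  set x₂ : A.domain := ⟨E.proj Bᶜ x, h.proj_mem_domain x.2 hB.compl⟩
  have hx : x = x₁ + x₂ := Subtype.ext (E.proj_add_proj_compl x hB).symm
  have h2 : E.proj B (A x₂) = 0 := by
    refine h.proj_apply_eq_zero x₂ hB ?_
    simp only [x₂, E.proj_proj hB hB.compl, inter_compl_self, E.proj_empty]; rfl
  have h1 : E.proj Bᶜ (A x₁) = 0 := by
    refine h.proj_apply_eq_zero x₁ hB.compl ?_
    simp only [x₁, E.proj_proj hB.compl hB, compl_inter_self, E.proj_empty]; rfl
  rw [hx, LinearPMap.map_add, map_add, h2, add_zero]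
  simpa [h1] using E.proj_add_proj_compl (A x₁) hB

/-- The compression of `A - b` to the range of `E[a, b]` has quadratic form `∫_{[a,b]} (t - b)`.
This is real, so the compression is symmetric, and it is bounded by `b - a`, which then bounds the
norm. -/
theorem norm_sub_smul_le (h : E.IsSpectralMeasureOf A) {a b : ℝ} (hab : a ≤ b) (x : A.domain)
    (hx : E.proj (Icc a b) x = x) :
    ‖A x - (b : ℂ) • (x : H)‖ ≤ (b - a) * ‖(x : H)‖ := by
  have hI : MeasurableSet (Icc a b) := measurableSet_Icc
  have hmem (y : H) : E.proj (Icc a b) y ∈ A.domain :=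
    h.proj_mem_domain_of_subset_Icc y hI subset_rfl
  let T : H →ₗ[ℂ] H := A.toFun ∘ₗ (E.proj (Icc a b)).toLinearMap.codRestrict A.domain hmem -
    (b : ℂ) • (E.proj (Icc a b)).toLinearMap
  have hT (y : H) : T y = A ⟨_, hmem y⟩ - (b : ℂ) • E.proj (Icc a b) y := rfl
  have hq (y : H) : inner ℂ y (T y) =
      ((∫ t in Icc a b, (t - b) ∂(E.scalarMeasure y) : ℝ) : ℂ) := by
    have hintg := h.integrable_id (hmem y)
    rw [E.scalarMeasure_proj y hI] at hintg
    have h1 : inner ℂ y (A ⟨_, hmem y⟩) = inner ℂ (E.proj (Icc a b) y) (A ⟨_, hmem y⟩) := by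
      rw [(E.isStarProjection _ hI).inner_left, h.proj_apply ⟨_, hmem y⟩ hI]
      congr 3
      exact ((E.isStarProjection _ hI).apply_apply y).symm
    have h2 := h.2 ⟨_, hmem y⟩
    simp only [E.scalarMeasure_proj y hI] at h2
    rw [hT, inner_sub_right, h1, h2, inner_smul_right,
      (E.isStarProjection _ hI).inner_apply_self, integral_sub hintg (integrable_const _),
      integral_const, ← E.scalarMeasure_proj y hI, E.scalarMeasure_real_univ]
    simp only [smul_eq_mul]
    push_cast
    ring
  have hsym : T.IsSymmetric := by
    rw [LinearMap.isSymmetric_iff_inner_map_self_real]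
    intro y
    rw [inner_conj_symm, hq y, ← inner_conj_symm, hq y, Complex.conj_ofReal]
  have hb (y : H) : |(inner ℂ y (T y)).re| ≤ (b - a) * ‖y‖ ^ 2 := by
    rw [hq y, Complex.ofReal_re]
    rw [← E.scalarMeasure_real_univ y]
    refine (norm_setIntegral_le_of_norm_le_const (measure_lt_top (E.scalarMeasure y) _)
      (s := Icc a b) (f := fun t : ℝ => t - b) (C := b - a) fun t ht => ?_).trans ?_
    · rw [Real.norm_eq_abs, abs_le]
      exact ⟨by linarith [ht.1], by linarith [ht.2]⟩
    · exact mul_le_mul_of_nonneg_left (measureReal_mono (subset_univ _)) (by linarith)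
  have := hsym.norm_apply_le_of_abs_re_inner_le hb x
  rw [hT] at this
  simpa only [hx] using this

/-- On the range of `E(-∞, 0]` the form of `A` is nonpositive, so `⟨x, (b - A) x⟩ ≥ b ‖x‖²`;
conclude by Cauchy–Schwarz. -/
theorem mul_norm_le_norm_sub_smul (h : E.IsSpectralMeasureOf A) (b : ℝ) (x : A.domain)
    (hx : E.proj (Iic 0) x = x) : b * ‖(x : H)‖ ≤ ‖A x - (b : ℂ) • (x : H)‖ := by
  have h0 : ∫ t, t ∂(E.scalarMeasure (x : H)) ≤ 0 := by
    rw [← hx, E.scalarMeasure_proj _ measurableSet_Iic]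
    exact setIntegral_nonpos measurableSet_Iic fun t ht => ht
  have h1 : (inner ℂ (x : H) ((b : ℂ) • (x : H) - A x)).re =
      b * ‖(x : H)‖ ^ 2 - ∫ t, t ∂(E.scalarMeasure (x : H)) := by
    rw [inner_sub_right, h.2 x, inner_smul_right, inner_self_eq_norm_sq_to_K]
    simp only [Complex.coe_algebraMap]
    norm_cast
  have h2 := (Complex.re_le_norm _).trans
    (norm_inner_le_norm (𝕜 := ℂ) (x : H) ((b : ℂ) • (x : H) - A x))
  rw [h1, norm_sub_rev] at h2
  rcases (norm_nonneg (x : H)).eq_or_lt with h3 | h3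
  · rw [← h3, mul_zero]; positivity
  · refine le_of_mul_le_mul_left ?_ h3
    nlinarith

/-- Let `T = E'(-∞, 0] E[a, b]`. Here `A - b` has norm at most `b - a` on the range of `E[a, b]`,
expands by at least `b` on the range of `E'(-∞, 0]`, and commutes with both projections. Hence `‖T‖
≤ (1 - a/b) ‖T‖`, and `a > 0` forces `T = 0`. -/
theorem proj_Iic_proj_Icc {E' : ProjectionValuedMeasure H} (h : E.IsSpectralMeasureOf A)
    (h' : E'.IsSpectralMeasureOf A) {a b : ℝ} (ha : 0 < a) (hab : a ≤ b) (x : H) :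
    E'.proj (Iic 0) (E.proj (Icc a b) x) = 0 := by
  have hI : MeasurableSet (Icc a b) := measurableSet_Icc
  have hJ : MeasurableSet (Iic (0 : ℝ)) := measurableSet_Iic
  set T : H →L[ℂ] H := E'.proj (Iic 0) * E.proj (Icc a b) with hT
  have key (x : H) : ‖T x‖ ≤ (b - a) / b * ‖T‖ * ‖x‖ := by
    have hb : 0 < b := ha.trans_le hab
    have hmem : E.proj (Icc a b) x ∈ A.domain :=
      h.proj_mem_domain_of_subset_Icc x hI subset_rfl
    set y : A.domain := ⟨_, hmem⟩
    have hy : E.proj (Icc a b) y = y := (E.isStarProjection _ hI).apply_apply x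
    set z : A.domain := ⟨_, h'.proj_mem_domain y.2 hJ⟩
    have hz : E'.proj (Iic 0) z = z := (E'.isStarProjection _ hJ).apply_apply _
    have h1 := h'.mul_norm_le_norm_sub_smul b z hz
    have h2 := h.norm_sub_smul_le hab y hy
    have h3 : A z - (b : ℂ) • (z : H) = T (A y - (b : ℂ) • (y : H)) := by
      have h4 : E.proj (Icc a b) (A y) = A y := by
        rw [h.proj_apply y hI]
        congr 1
        exact Subtype.ext hy
      rw [hT, mul_apply_eq_comp, map_sub, map_smul, h4, hy, map_sub, map_smul,
        h'.proj_apply y hJ]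
    have h5 : ‖(y : H)‖ ≤ ‖x‖ :=
      ((E.proj (Icc a b)).le_of_opNorm_le ((E.isStarProjection _ hI).norm_le) x).trans_eq
        (one_mul _)
    have h6 : b * ‖T x‖ ≤ ‖T‖ * ((b - a) * ‖x‖) := by
      calc b * ‖T x‖ ≤ ‖T (A y - (b : ℂ) • (y : H))‖ := h3 ▸ h1
        _ ≤ ‖T‖ * ‖A y - (b : ℂ) • (y : H)‖ := T.le_opNorm _
        _ ≤ ‖T‖ * ((b - a) * ‖x‖) := by
          gcongr
          exact h2.trans (by gcongr)
    calc ‖T x‖ = b * ‖T x‖ / b := by field_simp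
      _ ≤ ‖T‖ * ((b - a) * ‖x‖) / b := by gcongr
      _ = _ := by ring
  have hb : 0 < b := ha.trans_le hab
  have hle : ‖T‖ ≤ (b - a) / b * ‖T‖ :=
    T.opNorm_le_bound (mul_nonneg (div_nonneg (by linarith) hb.le) (norm_nonneg _)) key
  have h0 : T = 0 := by
    rw [← norm_le_zero_iff]
    have h1 : (b - a) / b = 1 - a / b := by field_simp
    have h2 : 0 < a / b := by positivity
    rw [h1] at hle
    nlinarith [norm_nonneg T]
  simpa [hT] using congrArg (fun S : H →L[ℂ] H => S x) h0

/-- Exhausting `(0, ∞)` by the intervals `[1/(n+1), n+1]` upgrades `proj_Iic_proj_Icc` to `E'(-∞, 0]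
E(0, ∞) = 0`. -/
theorem proj_Ioi_mul_proj_Ioi {E' : ProjectionValuedMeasure H} (h : E.IsSpectralMeasureOf A)
    (h' : E'.IsSpectralMeasureOf A) :
    E'.proj (Ioi 0) * E.proj (Ioi 0) = E.proj (Ioi 0) := by
  have hJ : MeasurableSet (Iic (0 : ℝ)) := measurableSet_Iic
  have hU : (⋃ n : ℕ, Icc (1 / ((n : ℝ) + 1)) ((n : ℝ) + 1)) = Ioi 0 := by
    ext t
    simp only [mem_iUnion, mem_Icc, mem_Ioi]
    constructor
    · rintro ⟨n, hn, -⟩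
      exact lt_of_lt_of_le (by positivity) hn
    · intro ht
      obtain ⟨m, hm⟩ := exists_nat_one_div_lt ht
      obtain ⟨k, hk⟩ := exists_nat_ge t
      refine ⟨max m k, ?_, ?_⟩
      · refine le_trans ?_ hm.le
        gcongr
        exact le_max_left _ _
      · refine hk.trans ?_
        have : (k : ℝ) ≤ (max m k : ℕ) := by exact_mod_cast le_max_right m k
        linarith
  ext x
  have key (x : H) : E.proj (Ioi 0) (E'.proj (Iic 0) x) = 0 := by
    rw [← hU]
    refine E.proj_iUnion_eq_zero (fun n => measurableSet_Icc) fun n => ?_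
    have hI : MeasurableSet (Icc (1 / ((n : ℝ) + 1)) ((n : ℝ) + 1)) := measurableSet_Icc
    refine ext_inner_left ℂ fun w => ?_
    rw [← (E.isStarProjection _ hI).inner_left, ← (E'.isStarProjection _ hJ).inner_left,
      h.proj_Iic_proj_Icc h' (by positivity), inner_zero_left, inner_zero_right]
    have : (0 : ℝ) ≤ n := n.cast_nonneg
    rw [div_le_iff₀ (by positivity)]
    nlinarith
  have h0 : E'.proj (Iic 0) (E.proj (Ioi 0) x) = 0 := by
    refine ext_inner_left ℂ fun w => ?_
    rw [← (E'.isStarProjection _ hJ).inner_left,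
      ← (E.isStarProjection _ measurableSet_Ioi).inner_left, key, inner_zero_left,
      inner_zero_right]
  have h1 := E'.proj_add_proj_compl (E.proj (Ioi 0) x) hJ
  rw [h0, zero_add, compl_Iic] at h1
  exact h1

/-- The spectral projection onto `(0, ∞)` does not depend on the spectral measure. -/
theorem proj_Ioi_unique {E' : ProjectionValuedMeasure H} (h : E.IsSpectralMeasureOf A)
    (h' : E'.IsSpectralMeasureOf A) : E.proj (Ioi 0) = E'.proj (Ioi 0) := by
  have h1 := h.proj_Ioi_mul_proj_Ioi h'
  -- Each range contains the other; taking adjoints puts both products in the same order.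
  have h2 := congrArg star (h'.proj_Ioi_mul_proj_Ioi h)
  rw [star_mul, (E.isStarProjection _ measurableSet_Ioi).isSelfAdjoint.star_eq,
    (E'.isStarProjection _ measurableSet_Ioi).isSelfAdjoint.star_eq, h1] at h2
  exact h2

/-- Existence and uniqueness both hold, so the default value `0` in the definition is not taken. -/
theorem spectralProjection_Ioi (h : E.IsSpectralMeasureOf A) :
    spectralProjection A (Ioi 0) = E.proj (Ioi 0) := by
  have hex : ∃! P : H →L[ℂ] H,
      ∃ E : ProjectionValuedMeasure H, E.IsSpectralMeasureOf A ∧ E.proj (Ioi 0) = P := by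
    refine ⟨_, ⟨E, h, rfl⟩, ?_⟩
    rintro _ ⟨E', h', rfl⟩
    exact h'.proj_Ioi_unique h
  rw [spectralProjection, dif_pos hex]
  exact hex.unique hex.choose_spec.1 ⟨E, h, rfl⟩

end IsSpectralMeasureOf

end ProjectionValuedMeasure

end SpectralUniqueness

/-! ### Multiplication operators and their spectral measures -/

/-- By Pythagoras the squared error of a partial sum is `‖w‖² - ∑ ‖v i‖²`. This reduces strong
countable additivity of `indicatorPVM` to that of the measure with density `|f|²`. -/
theorem hasSum_of_pairwise_inner_eq_zero {ι H : Type*} [NormedAddCommGroup H]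
    [InnerProductSpace ℂ H] {v : ι → H} {w : H} (hv : ∀ i j, i ≠ j → inner ℂ (v i) (v j) = 0)
    (hw : ∀ i, inner ℂ w (v i) = ((‖v i‖ ^ 2 : ℝ) : ℂ))
    (hs : HasSum (fun i => ‖v i‖ ^ 2) (‖w‖ ^ 2)) : HasSum v w := by
  classical
  have key (s : Finset ι) : ‖w - ∑ i ∈ s, v i‖ ^ 2 = ‖w‖ ^ 2 - ∑ i ∈ s, ‖v i‖ ^ 2 := by
    have h1 : (inner ℂ w (∑ i ∈ s, v i)).re = ∑ i ∈ s, ‖v i‖ ^ 2 := by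
      rw [inner_sum, Finset.sum_congr rfl fun i _ => hw i, ← Complex.ofReal_sum,
        Complex.ofReal_re]
    have h2 : ‖∑ i ∈ s, v i‖ ^ 2 = ∑ i ∈ s, ‖v i‖ ^ 2 := by
      have h3 : inner ℂ (∑ i ∈ s, v i) (∑ i ∈ s, v i) = ((∑ i ∈ s, ‖v i‖ ^ 2 : ℝ) : ℂ) := by
        rw [sum_inner, Complex.ofReal_sum]
        refine Finset.sum_congr rfl fun i hi => ?_
        rw [inner_sum, Finset.sum_eq_single_of_mem i hi fun j _ hj => hv i j hj.symm,
          inner_self_eq_norm_sq_to_K]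
        norm_cast
      rw [inner_self_eq_norm_sq_to_K] at h3
      simp only [Complex.coe_algebraMap] at h3
      exact_mod_cast h3
    have h4 := norm_sub_sq (𝕜 := ℂ) w (∑ i ∈ s, v i)
    rw [h2] at h4
    simp only [RCLike.re_to_complex, h1] at h4
    rw [h4]; ring
  have h0 : Filter.Tendsto (fun s : Finset ι => ‖w - ∑ i ∈ s, v i‖ ^ 2) Filter.atTop (nhds 0) := by
    simp_rw [key]
    have h := (tendsto_const_nhds (x := ‖w‖ ^ 2)).sub hs
    rwa [sub_self] at h
  have h1 : Filter.Tendsto (fun s : Finset ι => ‖w - ∑ i ∈ s, v i‖) Filter.atTop (nhds 0) := by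
    simpa [Real.sqrt_sq] using h0.sqrt
  have h2 := tendsto_zero_iff_norm_tendsto_zero.2 h1
  have h3 := (tendsto_const_nhds (x := w)).sub h2
  simpa [HasSum] using h3

noncomputable section

namespace ProjectionValuedMeasure

variable {H : Type*} [NormedAddCommGroup H] [InnerProductSpace ℂ H] [CompleteSpace H]

/-- The image of a projection-valued measure under a measurable map. -/
def map (E : ProjectionValuedMeasure H) {φ : ℝ → ℝ} (hφ : Measurable φ) :
    ProjectionValuedMeasure H where
  proj B := E.proj (φ ⁻¹' B)
  isStarProjection B hB := E.isStarProjection _ (hφ hB)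
  proj_empty := E.proj_empty
  proj_univ := E.proj_univ
  proj_inter B B' hB hB' := E.proj_inter _ _ (hφ hB) (hφ hB')
  hasSum_iUnion B hB hd x := by
    rw [preimage_iUnion]
    exact E.hasSum_iUnion _ (fun n => hφ (hB n)) (fun m n h => (hd h).preimage φ) x

theorem scalarMeasure_map (E : ProjectionValuedMeasure H) {φ : ℝ → ℝ} (hφ : Measurable φ) (x : H) :
    (E.map hφ).scalarMeasure x = (E.scalarMeasure x).map φ := by
  ext B hB
  rw [Measure.map_apply hφ hB, scalarMeasure_apply _ _ hB, scalarMeasure_apply _ _ (hφ hB)]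
  rfl

/-- Transport of a projection-valued measure along a unitary. -/
def conj (E : ProjectionValuedMeasure H) (U : H ≃ₗᵢ[ℂ] H) : ProjectionValuedMeasure H where
  proj B := (U.symm : H →L[ℂ] H) ∘L E.proj B ∘L (U : H →L[ℂ] H)
  isStarProjection B hB := by
    have h := E.isStarProjection B hB
    constructor
    · ext x
      simp [h.apply_apply]
    · rw [ContinuousLinearMap.isSelfAdjoint_iff_isSymmetric]
      intro x y
      change inner ℂ (U.symm (E.proj B (U x))) y = inner ℂ x (U.symm (E.proj B (U y)))
      rw [← U.inner_map_map, U.apply_symm_apply, h.inner_left, ← U.inner_map_map x,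
        U.apply_symm_apply]
  proj_empty := by ext x; simp [E.proj_empty]
  proj_univ := by ext x; simp [E.proj_univ]
  proj_inter B B' hB hB' := by ext x; simp [E.proj_inter B B' hB hB']
  hasSum_iUnion B hB hd x :=
    (E.hasSum_iUnion B hB hd (U x)).mapL (U.symm : H →L[ℂ] H)

theorem conj_proj_apply (E : ProjectionValuedMeasure H) (U : H ≃ₗᵢ[ℂ] H) (B : Set ℝ) (x : H) :
    (E.conj U).proj B x = U.symm (E.proj B (U x)) := rfl

theorem scalarMeasure_conj (E : ProjectionValuedMeasure H) (U : H ≃ₗᵢ[ℂ] H) (x : H) :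
    (E.conj U).scalarMeasure x = E.scalarMeasure (U x) := by
  ext B hB
  rw [scalarMeasure_apply _ _ hB, scalarMeasure_apply _ _ hB, conj_proj_apply, U.symm.norm_map]

end ProjectionValuedMeasure

open Classical in
/-- Multiplication by the indicator function of `B` on `L²(ℝ)` (`0` if `B` is not measurable). -/
def indicatorMul (B : Set ℝ) : L2Line →L[ℂ] L2Line :=
  if hB : MeasurableSet B then
    LinearMap.mkContinuous
      { toFun := fun f => ((Lp.memLp f).indicator hB).toLp _
        map_add' := by
          intro f g
          ext1
          filter_upwards [((Lp.memLp (f + g)).indicator hB).coeFn_toLp,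
            Lp.coeFn_add f g, Lp.coeFn_add (((Lp.memLp f).indicator hB).toLp _)
              (((Lp.memLp g).indicator hB).toLp _), ((Lp.memLp f).indicator hB).coeFn_toLp,
            ((Lp.memLp g).indicator hB).coeFn_toLp] with x h1 h2 h3 h4 h5
          rw [h1, h3, Pi.add_apply, h4, h5]
          by_cases hx : x ∈ B
          · simpa only [indicator_of_mem hx, Pi.add_apply] using h2
          · simp [hx]
        map_smul' := by
          intro c f
          ext1
          filter_upwards [((Lp.memLp (c • f)).indicator hB).coeFn_toLp,
            Lp.coeFn_smul c f, Lp.coeFn_smul c (((Lp.memLp f).indicator hB).toLp _),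
            ((Lp.memLp f).indicator hB).coeFn_toLp] with x h1 h2 h3 h4
          rw [h1, RingHom.id_apply, h3, Pi.smul_apply, h4]
          by_cases hx : x ∈ B
          · simpa only [indicator_of_mem hx, Pi.smul_apply] using h2
          · simp [hx] }
      1 (fun f => by
        rw [one_mul]
        refine Lp.norm_le_norm_of_ae_le ?_
        filter_upwards [((Lp.memLp f).indicator hB).coeFn_toLp] with x hx
        rw [LinearMap.coe_mk, AddHom.coe_mk, hx]
        exact norm_indicator_le_norm_self _ _)
  else 0

theorem coeFn_indicatorMul {B : Set ℝ} (hB : MeasurableSet B) (f : L2Line) :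
    indicatorMul B f =ᵐ[volume] B.indicator f := by
  rw [indicatorMul, dif_pos hB]
  exact ((Lp.memLp f).indicator hB).coeFn_toLp

theorem inner_indicatorMul {B : Set ℝ} (hB : MeasurableSet B) (f g : L2Line) :
    inner ℂ f (indicatorMul B g) = ∫ x in B, inner ℂ (f x) (g x) := by
  rw [L2.inner_def, ← integral_indicator hB]
  refine integral_congr_ae ?_
  filter_upwards [coeFn_indicatorMul hB g] with x hx
  rw [hx]
  by_cases h : x ∈ B <;> simp [h]

theorem isStarProjection_indicatorMul {B : Set ℝ} (hB : MeasurableSet B) :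
    IsStarProjection (indicatorMul B) := by
  constructor
  · ext f
    filter_upwards [coeFn_indicatorMul hB f, coeFn_indicatorMul hB (indicatorMul B f)] with x h1 h2
    rw [mul_apply_eq_comp, h2, h1]
    by_cases h : x ∈ B <;> simp [h, h1]
  · rw [ContinuousLinearMap.isSelfAdjoint_iff_isSymmetric]
    intro f g
    change inner ℂ (indicatorMul B f) g = inner ℂ f (indicatorMul B g)
    rw [inner_indicatorMul hB, ← inner_conj_symm, inner_indicatorMul hB, ← integral_conj]
    simp only [inner_conj_symm]

theorem indicatorMul_inter {B C : Set ℝ} (hB : MeasurableSet B) (hC : MeasurableSet C) :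
    indicatorMul (B ∩ C) = indicatorMul B * indicatorMul C := by
  ext f
  filter_upwards [coeFn_indicatorMul hC f, coeFn_indicatorMul hB (indicatorMul C f),
    coeFn_indicatorMul (hB.inter hC) f] with x h1 h2 h3
  rw [mul_apply_eq_comp, h2, h3, ← indicator_indicator]
  by_cases h : x ∈ B <;> simp [h, h1]

theorem indicatorMul_empty : indicatorMul ∅ = 0 := by
  ext f
  filter_upwards [coeFn_indicatorMul .empty f] with x h1
  simp [h1]

theorem indicatorMul_univ : indicatorMul univ = 1 := by
  ext f
  filter_upwards [coeFn_indicatorMul .univ f] with x h1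
  simp [h1]

theorem lintegral_enorm_sq (f : L2Line) :
    ∫⁻ x, ‖f x‖ₑ ^ 2 = ENNReal.ofReal (‖f‖ ^ 2) := by
  have h := Lp.enorm_def f
  rw [eLpNorm_eq_lintegral_rpow_enorm_toReal two_ne_zero ENNReal.ofNat_ne_top] at h
  simp only [ENNReal.toReal_ofNat, ENNReal.rpow_ofNat] at h
  rw [ENNReal.ofReal_pow (norm_nonneg _), ofReal_norm, h, ← ENNReal.rpow_natCast,
    ← ENNReal.rpow_mul]
  norm_num

theorem withDensity_enorm_sq_apply {B : Set ℝ} (hB : MeasurableSet B) (f : L2Line) :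
    volume.withDensity (fun x => ‖f x‖ₑ ^ 2) B = ENNReal.ofReal (‖indicatorMul B f‖ ^ 2) := by
  rw [withDensity_apply _ hB, ← lintegral_enorm_sq, ← lintegral_indicator hB]
  refine lintegral_congr_ae ?_
  filter_upwards [coeFn_indicatorMul hB f] with x hx
  rw [hx]
  by_cases h : x ∈ B <;> simp [h]

/-- The projection-valued measure `B ↦ 1_B` of multiplication operators on `L²(ℝ)`. -/
def indicatorPVM : ProjectionValuedMeasure L2Line where
  proj := indicatorMul
  isStarProjection _ hB := isStarProjection_indicatorMul hB
  proj_empty := indicatorMul_empty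
  proj_univ := indicatorMul_univ
  proj_inter _ _ hB hC := indicatorMul_inter hB hC
  hasSum_iUnion B hB hd f := by
    have hU := MeasurableSet.iUnion hB
    have hmul {C D : Set ℝ} (hC : MeasurableSet C) (hD : MeasurableSet D) :
        inner ℂ (indicatorMul C f) (indicatorMul D f) = inner ℂ f (indicatorMul (C ∩ D) f) := by
      rw [(isStarProjection_indicatorMul hC).inner_left, indicatorMul_inter hC hD,
        mul_apply_eq_comp]
    refine hasSum_of_pairwise_inner_eq_zero (fun i j hij => ?_) (fun i => ?_) ?_
    · rw [hmul (hB i) (hB j), (hd hij).inter_eq, indicatorMul_empty]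
      simp
    · rw [hmul hU (hB i), inter_eq_right.2 (subset_iUnion B i),
        (isStarProjection_indicatorMul (hB i)).inner_apply_self]
    · have h := measure_iUnion (μ := volume.withDensity (fun x => ‖f x‖ₑ ^ 2)) hd hB
      simp only [withDensity_enorm_sq_apply hU, withDensity_enorm_sq_apply (hB _)] at h
      have h2 := ENNReal.hasSum_toReal (h ▸ ENNReal.ofReal_ne_top)
      rw [← ENNReal.tsum_toReal_eq (fun _ => ENNReal.ofReal_ne_top), ← h] at h2
      simpa [ENNReal.toReal_ofReal] using h2

theorem scalarMeasure_indicatorPVM (f : L2Line) :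
    indicatorPVM.scalarMeasure f = volume.withDensity (fun x => ‖f x‖ₑ ^ 2) := by
  ext B hB
  rw [indicatorPVM.scalarMeasure_apply f hB, withDensity_enorm_sq_apply hB]
  rfl

/-- An operator that the unitary `U` takes to multiplication by `c x` has spectral measure
`B ↦ U⁻¹ 1_{c x ∈ B} U`. -/
theorem isSpectralMeasureOf_of_mem_graph_iff (U : L2Line ≃ₗᵢ[ℂ] L2Line) (c : ℝ)
    {A : L2Line →ₗ.[ℂ] L2Line}
    (hA : ∀ f g, (f, g) ∈ A.graph ↔ ∀ᵐ x : ℝ, U g x = ((c * x : ℝ) : ℂ) * U f x) :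
    ((indicatorPVM.map (measurable_const_mul c)).conj U).IsSpectralMeasureOf A := by
  have hμ (f : L2Line) : ((indicatorPVM.map (measurable_const_mul c)).conj U).scalarMeasure f =
      (volume.withDensity (fun x => ‖U f x‖ₑ ^ 2)).map (c * ·) := by
    rw [ProjectionValuedMeasure.scalarMeasure_conj, ProjectionValuedMeasure.scalarMeasure_map,
      scalarMeasure_indicatorPVM]
  have hmeas (f : L2Line) : AEMeasurable (fun x => ‖U f x‖ₑ ^ 2) :=
    (Lp.aestronglyMeasurable (U f)).enorm.pow_const 2
  constructor
  · intro f
    have hsm : AEStronglyMeasurable (fun x : ℝ => ((c * x : ℝ) : ℂ) * U f x) volume :=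
      AEStronglyMeasurable.mul (by fun_prop) (Lp.aestronglyMeasurable (U f))
    have h1 : ∫⁻ t, ENNReal.ofReal (t ^ 2)
        ∂((indicatorPVM.map (measurable_const_mul c)).conj U).scalarMeasure f =
        ∫⁻ x, ‖((c * x : ℝ) : ℂ) * U f x‖ₑ ^ 2 := by
      rw [hμ, lintegral_map (by fun_prop) (by fun_prop),
        lintegral_withDensity_eq_lintegral_mul₀ (hmeas f) (by fun_prop)]
      refine lintegral_congr fun x => ?_
      rw [Pi.mul_apply, enorm_mul, mul_pow ‖_‖ₑ, mul_comm, ← sq_abs (c * x),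
        ENNReal.ofReal_pow (abs_nonneg _), ← Real.norm_eq_abs, ← Complex.norm_real, ofReal_norm]
    rw [h1, LinearPMap.mem_domain_iff]
    -- The finite second moment says exactly that `c x · U f` is in `L²`, that is, that it is `U g`
    -- for some `g`.
    have h2 : ∫⁻ x, ‖((c * x : ℝ) : ℂ) * U f x‖ₑ ^ 2 < ∞ ↔
        MemLp (fun x : ℝ => ((c * x : ℝ) : ℂ) * U f x) 2 volume := by
      rw [MemLp, eLpNorm_lt_top_iff_lintegral_rpow_enorm_lt_top two_ne_zero ENNReal.ofNat_ne_top]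
      simp only [hsm, true_and, ENNReal.toReal_ofNat, ENNReal.rpow_ofNat]
    rw [h2]
    constructor
    · rintro ⟨g, hg⟩
      exact (memLp_congr_ae ((hA f g).1 hg)).1 (Lp.memLp (U g))
    · intro h
      refine ⟨U.symm (h.toLp _), (hA _ _).2 ?_⟩
      rw [U.apply_symm_apply]
      exact h.coeFn_toLp
  · intro f
    have hg := (hA f (A f)).1 (A.mem_graph f)
    rw [hμ, integral_map (by fun_prop) (by fun_prop),
      integral_withDensity_eq_integral_toReal_smul₀ (hmeas f) (by simp), ← U.inner_map_map,
      L2.inner_def, ← integral_complex_ofReal]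
    refine integral_congr_ae ?_
    filter_upwards [hg] with x hx
    rw [hx, RCLike.inner_apply, mul_assoc, RCLike.mul_conj]
    simp
    ring

theorem positionOp_spectralProjection :
    spectralProjection positionOp (Ioi 0) = indicatorMul (Ioi 0) := by
  have h := isSpectralMeasureOf_of_mem_graph_iff (LinearIsometryEquiv.refl ℂ L2Line) 1
    (A := positionOp) (fun f g => by
      rw [positionOp_graph]
      simp only [one_mul]
      rfl)
  rw [h.spectralProjection_Ioi]
  ext1 f
  change indicatorMul ((1 * ·) ⁻¹' Ioi 0) f = indicatorMul (Ioi 0) f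
  simp

end

/-! ### The momentum operator on the Fourier side -/

open scoped FourierTransform

theorem TemperedDistribution.derivCLM_eq_lineDerivOp (T : 𝓢'(ℝ, ℂ)) :
    TemperedDistribution.derivCLM ℂ T = LineDeriv.lineDerivOp (1 : ℝ) T := by
  ext φ
  rw [TemperedDistribution.derivCLM_apply_apply, TemperedDistribution.lineDerivOp_apply_apply]
  congr 1

theorem ae_eq_of_integral_schwartz_mul_eq {g h : ℝ → ℂ} (hg : LocallyIntegrable g volume)
    (hh : LocallyIntegrable h volume)
    (H : ∀ φ : 𝓢(ℝ, ℂ), ∫ x, φ x * g x = ∫ x, φ x * h x) : g =ᵐ[volume] h := by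
  refine ae_eq_of_integral_contDiff_smul_eq hg hh fun φ hφ hc => ?_
  have h₁ : HasCompactSupport (Complex.ofRealCLM ∘ φ) := hc.comp_left rfl
  have h₂ : ContDiff ℝ (⊤ : ℕ∞) (Complex.ofRealCLM ∘ φ) := by fun_prop
  simpa using H (h₁.toSchwartzMap h₂)

theorem toTemperedDistribution_eq_smulLeftCLM_iff {c : ℂ} (g h : L2Line) :
    (Lp.toTemperedDistribution g : 𝓢'(ℝ, ℂ)) =
      c • TemperedDistribution.smulLeftCLM ℂ (fun x : ℝ => (x : ℂ))
        (Lp.toTemperedDistribution h) ↔ ∀ᵐ x : ℝ, g x = c * (x : ℂ) * h x := by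
  have hx : Function.HasTemperateGrowth (fun x : ℝ => (x : ℂ)) := by fun_prop
  have happ (φ : 𝓢(ℝ, ℂ)) : (c • TemperedDistribution.smulLeftCLM ℂ (fun x : ℝ => (x : ℂ))
      (Lp.toTemperedDistribution h) : 𝓢'(ℝ, ℂ)) φ = ∫ x : ℝ, φ x * (c * (x : ℂ) * h x) := by
    change c • (TemperedDistribution.smulLeftCLM ℂ (fun x : ℝ => (x : ℂ))
      (Lp.toTemperedDistribution h) : 𝓢'(ℝ, ℂ)) φ = _
    rw [TemperedDistribution.smulLeftCLM_apply_apply, Lp.toTemperedDistribution_apply,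
      ← integral_smul]
    refine integral_congr_ae (ae_of_all _ fun x => ?_)
    simp only [SchwartzMap.smulLeftCLM_apply_apply hx, smul_eq_mul]
    ring
  constructor
  · intro H
    refine ae_eq_of_integral_schwartz_mul_eq ((Lp.memLp g).locallyIntegrable one_le_two) ?_ ?_
    · have h1 := (Lp.memLp h).locallyIntegrable one_le_two
      have h2 : Continuous (fun x : ℝ => c * (x : ℂ)) := by fun_prop
      rw [← locallyIntegrableOn_univ] at h1 ⊢
      exact h1.continuousOn_mul h2.continuousOn isOpen_univ.isLocallyClosed
    · intro φ
      rw [← happ, ← H, Lp.toTemperedDistribution_apply]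
      rfl
  · intro H
    ext φ
    rw [happ, Lp.toTemperedDistribution_apply]
    refine integral_congr_ae ?_
    filter_upwards [H] with x hx
    rw [hx, smul_eq_mul]

/-- The Fourier transform is injective on tempered distributions and turns the derivative into
multiplication by `2πix`; the prefactor is `-iħ · 2πi = 2πħ`. -/
theorem mem_momentumGraph_iff (hbar : ℝ) (f g : L2Line) :
    (f, g) ∈ momentumGraph hbar ↔ ∀ᵐ x : ℝ, Lp.fourierTransformₗᵢ ℝ ℂ g x =
      ((2 * Real.pi * hbar * x : ℝ) : ℂ) * Lp.fourierTransformₗᵢ ℝ ℂ f x := by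
  have hinj : Function.Injective (fun T : 𝓢'(ℝ, ℂ) => 𝓕 T) :=
    Function.LeftInverse.injective (g := fun T : 𝓢'(ℝ, ℂ) => 𝓕⁻ T)
      FourierTransform.fourierInv_fourier_eq
  have h1 : (f, g) ∈ momentumGraph hbar ↔ (Lp.toTemperedDistribution g : 𝓢'(ℝ, ℂ)) =
      (-(Complex.I * (hbar : ℂ))) •
        LineDeriv.lineDerivOp (1 : ℝ) (Lp.toTemperedDistribution f : 𝓢'(ℝ, ℂ)) := by
    rw [← TemperedDistribution.derivCLM_eq_lineDerivOp]
    rfl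
  rw [h1, ← hinj.eq_iff]
  simp only [FourierTransform.fourier_smul]
  rw [TemperedDistribution.fourier_lineDerivOp_eq, Lp.fourier_toTemperedDistribution_eq,
    Lp.fourier_toTemperedDistribution_eq, smul_smul]
  have hinner : (fun x : ℝ => ((inner ℝ x (1 : ℝ) : ℝ) : ℂ)) = fun x : ℝ => (x : ℂ) := by
    ext x
    simp
  rw [hinner, toTemperedDistribution_eq_smulLeftCLM_iff]
  refine Filter.eventually_congr (ae_of_all _ fun x => ?_)
  have hc : -(Complex.I * (hbar : ℂ)) * (2 * (Real.pi : ℂ) * Complex.I) * x =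
      ((2 * Real.pi * hbar * x : ℝ) : ℂ) := by
    push_cast
    linear_combination (-2 * hbar * Real.pi * x : ℂ) * Complex.I_sq
  rw [hc]
  rfl

theorem momentumOp_spectralProjection_apply {hbar : ℝ} (hpos : 0 < hbar) (f : L2Line) :
    spectralProjection (momentumOp hbar) (Ioi 0) f =
      (Lp.fourierTransformₗᵢ ℝ ℂ).symm (indicatorMul (Ioi 0) (Lp.fourierTransformₗᵢ ℝ ℂ f)) := by
  have h := isSpectralMeasureOf_of_mem_graph_iff (Lp.fourierTransformₗᵢ ℝ ℂ)
    (2 * Real.pi * hbar) (A := momentumOp hbar) (fun f g => by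
      rw [momentumOp_graph, mem_momentumGraph_iff])
  rw [h.spectralProjection_Ioi]
  -- The dependence on `ħ` disappears here: positive dilations preserve the half-line.
  have hpre : (2 * Real.pi * hbar * ·) ⁻¹' Ioi 0 = Ioi (0 : ℝ) := by
    ext x
    have : 0 < 2 * Real.pi * hbar := by positivity
    simp [this]
  change (Lp.fourierTransformₗᵢ ℝ ℂ).symm (indicatorMul ((2 * Real.pi * hbar * ·) ⁻¹' Ioi 0)
    (Lp.fourierTransformₗᵢ ℝ ℂ f)) = _
  rw [hpre]

/-- On `L¹ ∩ L²` the Fourier transform of `L²` is given by the Fourier integral. -/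
theorem coeFn_fourierTransform_toLp {f : ℝ → ℂ} (h1 : Integrable f) (h2 : MemLp f 2 volume) :
    Lp.fourierTransformₗᵢ ℝ ℂ (h2.toLp f) =ᵐ[volume] 𝓕 f := by
  have hcont : Continuous (𝓕 f) :=
    VectorFourier.fourierIntegral_continuous Real.continuous_fourierChar
      (by exact continuous_inner) h1
  refine ae_eq_of_integral_schwartz_mul_eq ((Lp.memLp _).locallyIntegrable one_le_two)
    hcont.locallyIntegrable fun φ => ?_
  have h3 := congrArg (fun T : 𝓢'(ℝ, ℂ) => T φ) (Lp.fourier_toTemperedDistribution_eq (h2.toLp f))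
  simp only [TemperedDistribution.fourier_apply, Lp.toTemperedDistribution_apply,
    smul_eq_mul] at h3
  refine h3.symm.trans ?_
  have h4 := VectorFourier.integral_fourierIntegral_smul_eq_flip (μ := volume) (ν := volume)
    (L := innerₗ ℝ) Real.continuous_fourierChar continuous_inner φ.integrable h1
  rw [flip_innerₗ] at h4
  refine Eq.trans ?_ h4
  refine integral_congr_ae ?_
  filter_upwards [h2.coeFn_toLp] with x hx
  rw [hx]
  rfl

/-! ### Upper bound for commutators of projections -/

section CommutatorBound

variable {H : Type*} [NormedAddCommGroup H] [InnerProductSpace ℂ H] [CompleteSpace H]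

namespace IsStarProjection

theorem norm_sq_add_norm_sq {P : H →L[ℂ] H} (hP : IsStarProjection P) (x : H) :
    ‖P x‖ ^ 2 + ‖x - P x‖ ^ 2 = ‖x‖ ^ 2 := by
  have h0 : inner ℂ (P x) (x - P x) = 0 := by
    rw [inner_sub_right, hP.inner_left, hP.inner_left, hP.apply_apply, sub_self]
  have h1 := norm_add_sq_eq_norm_sq_add_norm_sq_of_inner_eq_zero _ _ h0
  rw [add_sub_cancel] at h1
  nlinarith

/-- With `s = ‖P Q x‖` and `c = ‖(1 - P) Q x‖`, one has `s² + c² = ‖Q x‖² = ⟨x, (1 - P) Q x⟩ ≤ ‖x‖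
c`, so `s² ≤ c (‖x‖ - c) ≤ ‖x‖² / 4`. -/
theorem two_mul_norm_apply_apply_le {P Q : H →L[ℂ] H} (hP : IsStarProjection P)
    (hQ : IsStarProjection Q) {x : H} (hx : P x = 0) : 2 * ‖P (Q x)‖ ≤ ‖x‖ := by
  have h1 := hP.norm_sq_add_norm_sq (Q x)
  have h2 : ‖Q x‖ ^ 2 ≤ ‖x‖ * ‖Q x - P (Q x)‖ := by
    have h3 : inner ℂ x (Q x - P (Q x)) = ((‖Q x‖ ^ 2 : ℝ) : ℂ) := by
      rw [inner_sub_right, ← hP.inner_left, hx, inner_zero_left, sub_zero, hQ.inner_apply_self]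
    have h4 := norm_inner_le_norm (𝕜 := ℂ) x (Q x - P (Q x))
    rwa [h3, Complex.norm_real, Real.norm_of_nonneg (by positivity)] at h4
  refine le_of_sq_le_sq ?_ (norm_nonneg x)
  nlinarith [sq_nonneg (‖x‖ - 2 * ‖Q x - P (Q x)‖)]

/-- The commutator of two orthogonal projections has norm at most `1 / 2`. -/
theorem norm_lie_le {P Q : H →L[ℂ] H} (hP : IsStarProjection P) (hQ : IsStarProjection Q) :
    ‖⁅P, Q⁆‖ ≤ 1 / 2 := by
  refine ContinuousLinearMap.opNorm_le_bound _ (by norm_num) fun x => ?_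
  have hC : ⁅P, Q⁆ x = P (Q x) - Q (P x) := rfl
  set u := P x with hu
  set v := x - P x with hv
  have hPu : P u = u := hP.apply_apply x
  have hPv : P v = 0 := by rw [hv, map_sub, hP.apply_apply, sub_self]
  have hx : x = u + v := by rw [hu, hv]; abel
  -- The commutator is off-diagonal: `⁅P, Q⁆ x = P Q v - (1 - P) Q u`, with orthogonal terms, each
  -- controlled by the block estimate.
  have h1 : P (⁅P, Q⁆ x) = P (Q v) := by
    rw [hC, map_sub, hP.apply_apply, hv, map_sub, map_sub, hu]
  have h2 : ⁅P, Q⁆ x - P (⁅P, Q⁆ x) = -(Q u - P (Q u)) := by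
    rw [h1, hC, hx, map_add, map_add]
    abel
  have h3 := hP.norm_sq_add_norm_sq (⁅P, Q⁆ x)
  have h4 := hP.norm_sq_add_norm_sq x
  rw [h2, norm_neg, h1] at h3
  have h5 := hP.two_mul_norm_apply_apply_le hQ hPv
  have h6 := hP.one_sub.two_mul_norm_apply_apply_le hQ (x := u) (by simp [hPu])
  have h7 : (1 - P) (Q u) = Q u - P (Q u) := rfl
  rw [h7] at h6
  refine le_of_sq_le_sq ?_ (by positivity)
  have h8 : (2 * ‖P (Q v)‖) ^ 2 ≤ ‖v‖ ^ 2 := by gcongr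
  have h9 : (2 * ‖Q u - P (Q u)‖) ^ 2 ≤ ‖u‖ ^ 2 := by gcongr
  nlinarith

end IsStarProjection

end CommutatorBound

/-! ### Euler's integral with complex rate -/

section GammaFourier

open Complex in
/-- The Euler integral for the Gamma function, with a complex rate. -/
theorem integral_rpow_mul_cexp_neg_mul_Ioi {a : ℝ} (ha : 0 < a) {z : ℂ} (hz : 0 < z.re) :
    ∫ t : ℝ in Ioi 0, ((t ^ (a - 1) : ℝ) : ℂ) * cexp (-(z * t)) =
      (Real.Gamma a : ℂ) * z ^ (-(a : ℂ)) := by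
  have hmeas : Measurable (fun t : ℝ => ENNReal.ofReal (t ^ (a - 1))) := by fun_prop
  -- The integral is the complex moment generating function of `t^(a-1) dt` at `-z`, hence analytic
  -- for `Re z > 0`. The identity theorem extends the formula from real `z` near `1`.
  let μ : Measure ℝ := (volume.restrict (Ioi 0)).withDensity (fun t => ENNReal.ofReal (t ^ (a - 1)))
  have hintg : Iio 0 ⊆ ProbabilityTheory.integrableExpSet (id : ℝ → ℝ) μ := by
    intro r hr
    change Integrable (fun t : ℝ => Real.exp (r * t)) μ
    rw [integrable_withDensity_iff_integrable_smul' hmeas (by simp)]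
    have h1 := integrableOn_rpow_mul_exp_neg_mul_rpow (s := a - 1) (by linarith) one_pos
      (b := -r) (by simpa using hr)
    refine h1.congr ?_
    filter_upwards [ae_restrict_mem measurableSet_Ioi] with t ht
    have ht : 0 < t := ht
    rw [ENNReal.toReal_ofReal (by positivity)]
    simp
  have hF (z : ℂ) : ProbabilityTheory.complexMGF id μ (-z) =
      ∫ t : ℝ in Ioi 0, ((t ^ (a - 1) : ℝ) : ℂ) * cexp (-(z * t)) := by
    rw [ProbabilityTheory.complexMGF, integral_withDensity_eq_integral_toReal_smul hmeas (by simp)]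
    refine setIntegral_congr_fun measurableSet_Ioi fun t ht => ?_
    have ht : 0 < t := ht
    simp only [id, neg_mul]
    rw [ENNReal.toReal_ofReal (by positivity), real_smul]
  have hana : AnalyticOnNhd ℂ (fun z => ProbabilityTheory.complexMGF id μ (-z)) {z | 0 < z.re} := by
    intro w hw
    refine (ProbabilityTheory.analyticAt_complexMGF ?_).fun_comp analyticAt_id.neg
    exact interior_maximal hintg isOpen_Iio (by simpa using hw)
  have hana' : AnalyticOnNhd ℂ (fun z => (Real.Gamma a : ℂ) * z ^ (-(a : ℂ))) {z | 0 < z.re} :=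
    fun w hw => analyticAt_const.mul (analyticAt_id.cpow analyticAt_const (Or.inl hw))
  have heq : ∃ᶠ w in nhdsWithin (1 : ℂ) {1}ᶜ, ProbabilityTheory.complexMGF id μ (-w) =
      (Real.Gamma a : ℂ) * w ^ (-(a : ℂ)) := by
    have hreal (r : ℝ) (hr : 0 < r) : ProbabilityTheory.complexMGF id μ (-(r : ℂ)) =
        (Real.Gamma a : ℂ) * (r : ℂ) ^ (-(a : ℂ)) := by
      rw [hF]
      have h1 := integral_cpow_mul_exp_neg_mul_Ioi (a := a) (by simpa using ha) hr
      rw [Complex.Gamma_ofReal] at h1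
      rw [cpow_neg, ← one_div, mul_comm]
      have h2 : (1 : ℂ) / (r : ℂ) ^ (a : ℂ) = (1 / (r : ℂ)) ^ (a : ℂ) := by
        rw [one_div, one_div, inv_cpow]
        rw [arg_ofReal_of_nonneg hr.le]
        exact Real.pi_pos.ne
      rw [h2, ← h1]
      refine setIntegral_congr_fun measurableSet_Ioi fun t ht => ?_
      have ht : 0 < t := ht
      rw [ofReal_cpow ht.le]
      push_cast
      rfl
    have ht : Filter.Tendsto (fun r : ℝ => (r : ℂ)) (nhdsWithin 1 {1}ᶜ)
        (nhdsWithin (1 : ℂ) {1}ᶜ) := by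
      refine tendsto_nhdsWithin_iff.2 ⟨?_, ?_⟩
      · exact (continuous_ofReal.tendsto' 1 1 (by simp)).mono_left nhdsWithin_le_nhds
      · filter_upwards [self_mem_nhdsWithin] with r hr
        simpa using hr
    refine ht.frequently (Filter.Eventually.frequently ?_)
    have : ∀ᶠ r : ℝ in nhds 1, 0 < r := lt_mem_nhds one_pos
    filter_upwards [this.filter_mono nhdsWithin_le_nhds] with r hr using hreal r hr
  have hpre : IsPreconnected {z : ℂ | 0 < z.re} := (convex_halfSpace_re_gt 0).isPreconnected
  rw [← hF]
  exact hana.eqOn_of_preconnected_of_frequently_eq hana' hpre (by simp) heq hz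

end GammaFourier

/-! ### Test functions on the half-line and their Fourier transforms -/

noncomputable section HalfLineTestFunction

/-- The density `x ^ (a - 1) * exp (-x)` of the Gamma distribution on the half-line. -/
def gammaWeight (a : ℝ) (x : ℝ) : ℂ :=
  (Ioi (0 : ℝ)).indicator (fun t => ((t ^ (a - 1) * Real.exp (-t) : ℝ) : ℂ)) x

theorem gammaWeight_of_pos (a : ℝ) {x : ℝ} (hx : 0 < x) :
    gammaWeight a x = ((x ^ (a - 1) * Real.exp (-x) : ℝ) : ℂ) :=
  indicator_of_mem (mem_Ioi.2 hx) _

theorem gammaWeight_of_nonpos (a : ℝ) {x : ℝ} (hx : x ≤ 0) : gammaWeight a x = 0 :=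
  indicator_of_notMem (by simpa using hx) _

theorem integrable_gammaWeight {a : ℝ} (ha : 0 < a) : Integrable (gammaWeight a) := by
  refine (integrable_indicator_iff measurableSet_Ioi).2 ?_
  have h := (Real.GammaIntegral_convergent ha).ofReal (𝕜 := ℂ)
  refine h.congr (ae_of_all _ fun t => ?_)
  simp only [mul_comm]
  rfl

theorem norm_gammaWeight_sq (a : ℝ) :
    (fun x => ‖gammaWeight a x‖ ^ 2) = (Ioi (0 : ℝ)).indicator
      (fun t => t ^ (2 * a - 1 - 1) * Real.exp (-(2 * t))) := by
  ext x
  rcases lt_or_ge 0 x with hx | hx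
  · rw [gammaWeight_of_pos a hx, Complex.norm_real, Real.norm_of_nonneg (by positivity),
      indicator_of_mem (mem_Ioi.2 hx), mul_pow, ← Real.rpow_mul_natCast hx.le,
      ← Real.exp_nat_mul]
    push_cast
    ring_nf
  · simp [gammaWeight_of_nonpos a hx, hx]

theorem memLp_gammaWeight {a : ℝ} (ha : 1 / 2 < a) : MemLp (gammaWeight a) 2 volume := by
  rw [memLp_two_iff_integrable_sq_norm (integrable_gammaWeight (by linarith)).1,
    norm_gammaWeight_sq, integrable_indicator_iff measurableSet_Ioi]
  have h1 := integrableOn_rpow_mul_exp_neg_mul_rpow (s := 2 * a - 1 - 1) (by linarith) one_pos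
    (b := 2) (by norm_num)
  simpa using h1

/-- For `a = 1/2 + δ` this blows up like `1/(2δ)`, the same rate as the matrix coefficient in
`inner_gammaWeight`. -/
theorem norm_sq_toLp_gammaWeight {a : ℝ} (ha : 1 / 2 < a) :
    ‖(memLp_gammaWeight ha).toLp‖ ^ 2 = (1 / 2) ^ (2 * a - 1) * Real.Gamma (2 * a - 1) := by
  have h1 := lintegral_enorm_sq ((memLp_gammaWeight ha).toLp)
  have h2 : ∫⁻ x, ‖((memLp_gammaWeight ha).toLp (gammaWeight a)) x‖ₑ ^ 2 =
      ∫⁻ x, ENNReal.ofReal (‖gammaWeight a x‖ ^ 2) := by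
    refine lintegral_congr_ae ?_
    filter_upwards [(memLp_gammaWeight ha).coeFn_toLp] with x hx
    rw [hx, ENNReal.ofReal_pow (norm_nonneg _), ofReal_norm]
  have hintg := (memLp_two_iff_integrable_sq_norm
    (integrable_gammaWeight (by linarith)).1).1 (memLp_gammaWeight ha)
  rw [h2, ← ofReal_integral_eq_lintegral_ofReal hintg (ae_of_all _ fun x => by positivity),
    ENNReal.ofReal_eq_ofReal_iff (integral_nonneg fun x => by positivity) (by positivity)] at h1
  rw [← h1, norm_gammaWeight_sq, integral_indicator measurableSet_Ioi,
    Real.integral_rpow_mul_exp_neg_mul_Ioi (by linarith) two_pos]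

theorem fourier_gammaWeight {a : ℝ} (ha : 0 < a) (ξ : ℝ) :
    𝓕 (gammaWeight a) ξ =
      (Real.Gamma a : ℂ) * (1 + 2 * Real.pi * ξ * Complex.I) ^ (-(a : ℂ)) := by
  have h1 := integral_rpow_mul_cexp_neg_mul_Ioi ha
    (z := 1 + 2 * Real.pi * ξ * Complex.I) (by simp)
  rw [← h1, Real.fourier_eq', ← integral_indicator measurableSet_Ioi]
  refine integral_congr_ae (ae_of_all _ fun t => ?_)
  rcases lt_or_ge 0 t with ht | ht
  · simp only [gammaWeight_of_pos a ht, indicator_of_mem (mem_Ioi.2 ht)]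
    rw [Complex.ofReal_mul (t ^ _), Complex.ofReal_exp, smul_eq_mul, mul_left_comm,
      ← Complex.exp_add]
    congr 2
    simp
    ring
  · simp [gammaWeight_of_nonpos a ht, ht]

theorem memLp_gammaWeight_neg {a : ℝ} (ha : 1 / 2 < a) :
    MemLp (fun x => gammaWeight a (-x)) 2 volume :=
  (memLp_gammaWeight ha).comp_measurePreserving (Measure.measurePreserving_neg volume)

theorem norm_toLp_gammaWeight_neg {a : ℝ} (ha : 1 / 2 < a) :
    ‖(memLp_gammaWeight_neg ha).toLp‖ = ‖(memLp_gammaWeight ha).toLp‖ := by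
  rw [Lp.norm_toLp, Lp.norm_toLp]
  congr 1
  exact eLpNorm_comp_measurePreserving (memLp_gammaWeight ha).1
    (Measure.measurePreserving_neg volume)

theorem fourier_gammaWeight_neg {a : ℝ} (ha : 0 < a) (ξ : ℝ) :
    𝓕 (fun x => gammaWeight a (-x)) ξ =
      (Real.Gamma a : ℂ) * (1 - 2 * Real.pi * ξ * Complex.I) ^ (-(a : ℂ)) := by
  have h1 := fourier_gammaWeight ha (-ξ)
  rw [Real.fourier_eq'] at h1 ⊢
  rw [← integral_neg_eq_self]
  simp only [neg_neg, inner_neg_left, inner_neg_right] at h1 ⊢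
  rw [h1]
  push_cast
  ring_nf

theorem re_one_sub_pos (ξ : ℝ) : 0 < (1 - 2 * Real.pi * ξ * Complex.I : ℂ).re := by simp

/-- An antiderivative for the integrand in `inner_gammaWeight`; the constant is `(-2δ)(-2πi) =
4πiδ`. -/
theorem hasDerivAt_one_sub_cpow {δ : ℝ} (hδ : 0 < δ) (ξ : ℝ) :
    HasDerivAt (fun ξ : ℝ => (1 - 2 * Real.pi * ξ * Complex.I : ℂ) ^ (-(2 * δ : ℂ)) /
        (4 * Real.pi * δ * Complex.I))
      ((1 - 2 * Real.pi * ξ * Complex.I : ℂ) ^ (-(1 + 2 * δ : ℂ))) ξ := by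
  have h1 : HasDerivAt (fun ξ : ℝ => (1 - 2 * Real.pi * ξ * Complex.I : ℂ))
      (-(2 * Real.pi * Complex.I)) ξ := by
    have h := ((Complex.ofRealCLM.hasDerivAt (x := ξ)).const_mul
      (2 * Real.pi * Complex.I : ℂ)).const_sub 1
    simp only [Complex.ofRealCLM_apply, Complex.ofReal_one, mul_one] at h
    have hfun : (fun ξ : ℝ => (1 - 2 * Real.pi * ξ * Complex.I : ℂ)) =
        fun ξ : ℝ => 1 - 2 * Real.pi * Complex.I * ξ := by
      ext ξ
      ring
    rw [hfun]
    exact h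
  have h2 := (((hasDerivAt_id (1 - 2 * Real.pi * ξ * Complex.I : ℂ)).cpow_const
    (c := -(2 * δ : ℂ)) (Or.inl (re_one_sub_pos ξ))).comp ξ h1).div_const
    (4 * Real.pi * δ * Complex.I)
  simp only [id, mul_one] at h2
  refine h2.congr_deriv ?_
  have hπ : (Real.pi : ℂ) ≠ 0 := by exact_mod_cast Real.pi_ne_zero
  have hδ' : (δ : ℂ) ≠ 0 := by exact_mod_cast hδ.ne'
  have he : -(2 * δ : ℂ) - 1 = -(1 + 2 * δ : ℂ) := by ring
  rw [he]
  field_simp [Complex.I_ne_zero]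
  ring

theorem tendsto_one_sub_cpow {δ : ℝ} (hδ : 0 < δ) :
    Filter.Tendsto (fun ξ : ℝ => (1 - 2 * Real.pi * ξ * Complex.I : ℂ) ^ (-(2 * δ : ℂ)) /
        (4 * Real.pi * δ * Complex.I)) Filter.atTop (nhds 0) := by
  have h1 : Filter.Tendsto (fun ξ : ℝ => ‖(1 - 2 * Real.pi * ξ * Complex.I : ℂ)‖)
      Filter.atTop Filter.atTop := by
    refine Filter.tendsto_atTop_mono (fun ξ => ?_) Filter.tendsto_id
    have h := Complex.abs_im_le_norm (1 - 2 * Real.pi * ξ * Complex.I : ℂ)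
    have him : (1 - 2 * Real.pi * ξ * Complex.I : ℂ).im = -(2 * Real.pi * ξ) := by simp
    rw [him, abs_neg, abs_mul, abs_of_pos Real.two_pi_pos] at h
    refine le_trans ?_ h
    have h1 : 1 ≤ 2 * Real.pi := by linarith [Real.pi_gt_three]
    exact (le_abs_self ξ).trans (le_mul_of_one_le_left (abs_nonneg ξ) h1)
  have h2 := (tendsto_rpow_neg_atTop (y := 2 * δ) (by positivity)).comp h1
  have h3 : Filter.Tendsto (fun ξ : ℝ => (1 - 2 * Real.pi * ξ * Complex.I : ℂ) ^ (-(2 * δ : ℂ)))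
      Filter.atTop (nhds 0) := by
    rw [tendsto_zero_iff_norm_tendsto_zero]
    refine h2.congr fun ξ => ?_
    have h4 := Complex.norm_cpow_real (1 - 2 * Real.pi * ξ * Complex.I : ℂ) (-(2 * δ))
    push_cast at h4
    rw [h4]
    rfl
  simpa using h3.div_const (4 * Real.pi * δ * Complex.I)

/-- Reflection and complex conjugation both send `1 + 2πiξ` to `1 - 2πiξ`, so the two factors merge
into one power. -/
theorem inner_fourier_gammaWeight {a : ℝ} (ha : 0 < a) (ξ : ℝ) :
    inner ℂ (𝓕 (gammaWeight a) ξ) (𝓕 (fun x => gammaWeight a (-x)) ξ) =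
      (Real.Gamma a : ℂ) ^ 2 * (1 - 2 * Real.pi * ξ * Complex.I) ^ (-(2 * a : ℂ)) := by
  have hz : (1 - 2 * Real.pi * ξ * Complex.I : ℂ) ≠ 0 := by
    intro h
    have := re_one_sub_pos ξ
    simp [h] at this
  have harg : (1 + 2 * Real.pi * ξ * Complex.I : ℂ).arg ≠ Real.pi := by
    intro h
    rw [Complex.arg_eq_pi_iff] at h
    have := h.1
    simp at this
    linarith
  have hconj : (starRingEnd ℂ) (1 + 2 * Real.pi * ξ * Complex.I) =
      1 - 2 * Real.pi * ξ * Complex.I := by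
    apply Complex.ext <;> simp
  have hpow := Complex.conj_cpow _ (-(a : ℂ)) harg
  rw [map_neg, Complex.conj_ofReal, hconj] at hpow
  rw [fourier_gammaWeight ha, fourier_gammaWeight_neg ha, RCLike.inner_apply, map_mul,
    Complex.conj_ofReal, ← hpow]
  have : (-(2 * a) : ℂ) = -a + -a := by ring
  rw [this, Complex.cpow_add _ _ hz]
  ring

/-- The matrix coefficient of the momentum half-line projection between a function on the
positive half-line and its reflection. -/
theorem inner_gammaWeight {δ : ℝ} (hδ : 0 < δ) (ha : 1 / 2 < 1 / 2 + δ) :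
    inner ℂ ((memLp_gammaWeight ha).toLp : L2Line) ((Lp.fourierTransformₗᵢ ℝ ℂ).symm
      (indicatorMul (Ioi 0) (Lp.fourierTransformₗᵢ ℝ ℂ (memLp_gammaWeight_neg ha).toLp))) =
      (Real.Gamma (1 / 2 + δ) : ℂ) ^ 2 * -(1 / (4 * Real.pi * δ * Complex.I)) := by
  have ha' : 0 < 1 / 2 + δ := by linarith
  set u : L2Line := (memLp_gammaWeight ha).toLp with hu
  set v : L2Line := (memLp_gammaWeight_neg ha).toLp with hv
  have hintg := L2.integrable_inner (𝕜 := ℂ) (Lp.fourierTransformₗᵢ ℝ ℂ u)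
    (Lp.fourierTransformₗᵢ ℝ ℂ v)
  have hae : (fun ξ => inner ℂ (Lp.fourierTransformₗᵢ ℝ ℂ u ξ) (Lp.fourierTransformₗᵢ ℝ ℂ v ξ))
      =ᵐ[volume] fun ξ : ℝ => (Real.Gamma (1 / 2 + δ) : ℂ) ^ 2 *
        (1 - 2 * Real.pi * ξ * Complex.I) ^ (-(1 + 2 * δ : ℂ)) := by
    filter_upwards [coeFn_fourierTransform_toLp (integrable_gammaWeight ha')
      (memLp_gammaWeight ha), coeFn_fourierTransform_toLp (integrable_gammaWeight ha').comp_neg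
      (memLp_gammaWeight_neg ha)] with ξ h1 h2
    rw [h1, h2, inner_fourier_gammaWeight ha']
    push_cast
    ring_nf
  have hΓ : (Real.Gamma (1 / 2 + δ) : ℂ) ^ 2 ≠ 0 := by
    exact_mod_cast pow_ne_zero 2 (Real.Gamma_pos_of_pos ha').ne'
  -- Integrability comes for free: up to a nonzero constant this is the pointwise inner product of
  -- two `L²` functions.
  have hintg' : Integrable (fun ξ : ℝ =>
      (1 - 2 * Real.pi * ξ * Complex.I : ℂ) ^ (-(1 + 2 * δ : ℂ))) := by
    have := (hintg.congr hae).const_mul ((Real.Gamma (1 / 2 + δ) : ℂ) ^ 2)⁻¹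
    simpa only [inv_mul_cancel_left₀ hΓ] using this
  rw [← (Lp.fourierTransformₗᵢ ℝ ℂ).inner_map_map, LinearIsometryEquiv.apply_symm_apply,
    inner_indicatorMul measurableSet_Ioi,
    setIntegral_congr_ae measurableSet_Ioi (hae.mono fun ξ h _ => h), integral_const_mul,
    integral_Ioi_of_hasDerivAt_of_tendsto' (fun ξ _ => hasDerivAt_one_sub_cpow hδ ξ)
      hintg'.integrableOn (tendsto_one_sub_cpow hδ)]
  simp

end HalfLineTestFunction

/-! ### The norm of the commutator -/

/-- The commutator of the half-line projections in position and momentum. -/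
noncomputable def halfLineCommutator : L2Line →L[ℂ] L2Line :=
  ⁅indicatorMul (Ioi 0), (indicatorPVM.conj (Lp.fourierTransformₗᵢ ℝ ℂ)).proj (Ioi 0)⁆

theorem norm_halfLineCommutator_le : ‖halfLineCommutator‖ ≤ 1 / 2 :=
  (isStarProjection_indicatorMul measurableSet_Ioi).norm_lie_le
    (ProjectionValuedMeasure.isStarProjection _ _ measurableSet_Ioi)

/-- This is `|⟨u, C v⟩| ≤ ‖C‖ ‖u‖ ‖v‖` multiplied by `2δ`; since `2δ Γ(2δ) = Γ(2δ + 1)`, both sides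
stay finite as `δ → 0`. -/
theorem gamma_sq_le_norm_halfLineCommutator {δ : ℝ} (hδ : 0 < δ) :
    Real.Gamma (1 / 2 + δ) ^ 2 / (2 * Real.pi) ≤
      ‖halfLineCommutator‖ * ((1 / 2) ^ (2 * δ) * Real.Gamma (2 * δ + 1)) := by
  have ha : 1 / 2 < 1 / 2 + δ := by linarith
  set u : L2Line := (memLp_gammaWeight ha).toLp with hu
  set v : L2Line := (memLp_gammaWeight_neg ha).toLp with hv
  have hPu : indicatorMul (Ioi 0) u = u := by
    ext1
    filter_upwards [coeFn_indicatorMul measurableSet_Ioi u,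
      (memLp_gammaWeight ha).coeFn_toLp] with x h1 h2
    rw [h1]
    by_cases hx : x ∈ Ioi (0 : ℝ)
    · rw [indicator_of_mem hx]
    · rw [indicator_of_notMem hx, h2, gammaWeight_of_nonpos _ (not_lt.1 hx)]
  have hPv : indicatorMul (Ioi 0) v = 0 := by
    ext1
    filter_upwards [coeFn_indicatorMul measurableSet_Ioi v, Lp.coeFn_zero ℂ 2 (volume : Measure ℝ),
      (memLp_gammaWeight_neg ha).coeFn_toLp] with x h1 h0 h2
    rw [h1, h0]
    by_cases hx : x ∈ Ioi (0 : ℝ)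
    · have hx : 0 < x := hx
      rw [indicator_of_mem (mem_Ioi.2 hx), h2, gammaWeight_of_nonpos _ (by linarith)]
      rfl
    · rw [indicator_of_notMem hx]
      rfl
  have h1 : inner ℂ u (halfLineCommutator v) =
      (Real.Gamma (1 / 2 + δ) : ℂ) ^ 2 * -(1 / (4 * Real.pi * δ * Complex.I)) := by
    have hC : halfLineCommutator v =
        indicatorMul (Ioi 0) ((indicatorPVM.conj (Lp.fourierTransformₗᵢ ℝ ℂ)).proj (Ioi 0) v) -
        (indicatorPVM.conj (Lp.fourierTransformₗᵢ ℝ ℂ)).proj (Ioi 0) (indicatorMul (Ioi 0) v) := rfl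
    rw [hC, hPv, map_zero, sub_zero,
      ← (isStarProjection_indicatorMul measurableSet_Ioi).inner_left, hPu]
    exact inner_gammaWeight hδ ha
  have h2 := (norm_inner_le_norm (𝕜 := ℂ) u (halfLineCommutator v)).trans
    (mul_le_mul_of_nonneg_left (halfLineCommutator.le_opNorm v) (norm_nonneg u))
  have hn : ‖u‖ ^ 2 = (1 / 2) ^ (2 * δ) * Real.Gamma (2 * δ) := by
    rw [hu, norm_sq_toLp_gammaWeight ha]
    ring_nf
  have hpos := Real.pi_pos
  rw [h1, hv, norm_toLp_gammaWeight_neg ha, ← hu] at h2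
  simp only [norm_mul, norm_pow, norm_neg, norm_div, norm_one, Complex.norm_I, Complex.norm_real,
    Real.norm_eq_abs, sq_abs, abs_of_pos hpos, abs_of_pos hδ, mul_one, Complex.norm_ofNat] at h2
  have h3 : Real.Gamma (1 / 2 + δ) ^ 2 / (2 * Real.pi) =
      2 * δ * (Real.Gamma (1 / 2 + δ) ^ 2 * (1 / (4 * Real.pi * δ))) := by
    field_simp
    ring
  rw [h3, Real.Gamma_add_one (by positivity)]
  calc _ ≤ 2 * δ * (‖u‖ * (‖halfLineCommutator‖ * ‖u‖)) := by gcongr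
    _ = 2 * δ * (‖halfLineCommutator‖ * ‖u‖ ^ 2) := by ring
    _ = _ := by rw [hn]; ring

theorem norm_halfLineCommutator : ‖halfLineCommutator‖ = 1 / 2 := by
  refine le_antisymm norm_halfLineCommutator_le ?_
  have hG (s : ℝ) (hs : 0 < s) : ContinuousAt Real.Gamma s :=
    (Real.differentiableAt_Gamma fun m => by
      have : (0 : ℝ) ≤ m := m.cast_nonneg
      linarith).continuousAt
  have hl : Filter.Tendsto (fun δ : ℝ => Real.Gamma (1 / 2 + δ) ^ 2 / (2 * Real.pi))
      (nhdsWithin 0 (Ioi 0)) (nhds (1 / 2)) := by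
    have h1 : ContinuousAt (fun δ : ℝ => Real.Gamma (1 / 2 + δ) ^ 2 / (2 * Real.pi)) 0 :=
      ((ContinuousAt.comp (g := Real.Gamma) (by simpa using hG (1 / 2) (by norm_num))
        (by fun_prop)).pow 2).div_const _
    have h2 := h1.tendsto.mono_left (nhdsWithin_le_nhds (s := Ioi 0))
    -- The sharp constant arises from `Γ(1/2)² = π`.
    have h3 : Real.Gamma (1 / 2 + 0) ^ 2 / (2 * Real.pi) = 1 / 2 := by
      rw [add_zero, Real.Gamma_one_half_eq, Real.sq_sqrt Real.pi_pos.le]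
      have := Real.pi_ne_zero
      field_simp
    rwa [h3] at h2
  have hr : Filter.Tendsto (fun δ : ℝ => ‖halfLineCommutator‖ *
      ((1 / 2) ^ (2 * δ) * Real.Gamma (2 * δ + 1))) (nhdsWithin 0 (Ioi 0))
      (nhds ‖halfLineCommutator‖) := by
    have h1 : ContinuousAt (fun δ : ℝ => ‖halfLineCommutator‖ *
        ((1 / 2 : ℝ) ^ (2 * δ) * Real.Gamma (2 * δ + 1))) 0 := by
      refine continuousAt_const.mul (ContinuousAt.mul ?_ ?_)
      · exact (Real.continuous_const_rpow (by norm_num)).continuousAt.comp (by fun_prop)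
      · exact ContinuousAt.comp (g := Real.Gamma) (by simpa using hG 1 one_pos) (by fun_prop)
    have h2 := h1.tendsto.mono_left (nhdsWithin_le_nhds (s := Ioi 0))
    simpa using h2
  refine le_of_tendsto_of_tendsto hl hr ?_
  filter_upwards [self_mem_nhdsWithin] with δ hδ using gamma_sq_le_norm_halfLineCommutator hδ

theorem mainTheorem6 :
    ∃ C : L2Line →L[ℂ] L2Line, (∀ hbar : ℝ, 0 < hbar → lineCommutator hbar = C) ∧ ‖C‖ = 1 / 2 := by
  refine ⟨halfLineCommutator, fun hbar hpos => ?_, norm_halfLineCommutator⟩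
  rw [lineCommutator, halfLineCommutator, positionOp_spectralProjection]
  congr 1
  ext1 f
  exact momentumOp_spectralProjection_apply hpos f
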